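/- For $n\ge 1$ and $|z|<1$ let $\mathrm{Li}_n(z)=\sum_{k\ge 1} z^k/k^n$, and define the real numbers $$C_n=\Re\left\{\left(\tfrac23\right)^{n-1}\mathrm{Li}_n\!\left(\tfrac{i}{\sqrt8}\right)-2^n\,\mathrm{Li}_n\!\left(\tfrac{-i}{\sqrt2}\right)\right\},\qquad D_n=\Re\left\{\left(\tfrac23\right)^{n-1}\mathrm{Li}_n\!\left(\tfrac{1+i}{4}\right)-\mathrm{Li}_n\!\left(\tfrac{-i}{2}\right)\right\}.$$ Let ${}_3F_2(a_1,a_2,a_3;b_1,b_2;z)=\sum_{k\ge0}\frac{(a_1)_k(a_2)_k(a_3)_k}{(b_1)_k(b_2)_k\,k!}z^k$ with $(a)_k=a(a+1)\cdots(a+k-1)$. (1) The series ${}_3F_2(-\tfrac t2,\tfrac12-\tfrac t6,1;1-\tfrac t2,1-\tfrac{2t}3;1)$ converges for every complex $t$ with $\Re t<1$ and is a holomorphic function of $t$ there; for $|t|<1$ the series $\sum_{n\ge1}C_nt^n$ converges and $$2\sum_{n\ge1}C_nt^n=1-{}_3F_2\!\left(-\tfrac t2,\ \tfrac12-\tfrac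 t6,\ 1;\ 1-\tfrac t2,\ 1-\tfrac{2t}3;\ 1\right).$$ (2) The series ${}_3F_2(-\tfrac t2,\tfrac12-\tfrac t3,1;1-\tfrac t2,1-\tfrac{2t}3;1)$ converges for every complex $t$ with $\Re t<\tfrac32$ and is a holomorphic function of $t$ there; for $|t|<\tfrac32$ the series $\sum_{n\ge1}D_nt^n$ converges and $$2\sum_{n\ge1}D_nt^n=1-{}_3F_2\!\left(-\tfrac t2,\ \tfrac12-\tfrac t3,\ 1;\ 1-\tfrac t2,\ 1-\tfrac{2t}3;\ 1\right).$$ -/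

import Mathlib

noncomputable section

/-- The polylogarithm `Li_n(z) = ∑_{k > 0} z ^ k / k ^ n`; it is used only at points with
`‖z‖ < 1`, where the series converges absolutely. -/
def polyLi (n : ℕ) (z : ℂ) : ℂ :=
  ∑' k : ℕ, z ^ (k + 1) / ((k : ℂ) + 1) ^ n

/-- The ladder `C_n = Re {(2/3)^(n-1) Li_n(i/√8) - 2^n Li_n(-i/√2)}`. -/
def ladderC (n : ℕ) : ℝ :=
  (((2 / 3 : ℂ) ^ ((n : ℤ) - 1)) * polyLi n (Complex.I / (Real.sqrt 8 : ℂ))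
    - (2 : ℂ) ^ n * polyLi n (-Complex.I / (Real.sqrt 2 : ℂ))).re

/-- The ladder `D_n = Re {(2/3)^(n-1) Li_n((1+i)/4) - Li_n(-i/2)}`. -/
def ladderD (n : ℕ) : ℝ :=
  (((2 / 3 : ℂ) ^ ((n : ℤ) - 1)) * polyLi n ((1 + Complex.I) / 4)
    - polyLi n (-Complex.I / 2)).re

/-- The `k`-th term of the hypergeometric series `₃F₂(a₁, a₂, a₃; b₁, b₂; z)`, where
`(ascPochhammer ℂ k).eval a = a (a + 1) ⋯ (a + k - 1)`. -/
def hyp3F2Term (a₁ a₂ a₃ b₁ b₂ z : ℂ) (k : ℕ) : ℂ :=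
  ((ascPochhammer ℂ k).eval a₁ * (ascPochhammer ℂ k).eval a₂ * (ascPochhammer ℂ k).eval a₃) /
    ((ascPochhammer ℂ k).eval b₁ * (ascPochhammer ℂ k).eval b₂ * (k.factorial : ℂ)) * z ^ k

/-- The hypergeometric series `₃F₂(a₁, a₂, a₃; b₁, b₂; z)`. -/
def hyp3F2 (a₁ a₂ a₃ b₁ b₂ z : ℂ) : ℂ :=
  ∑' k : ℕ, hyp3F2Term a₁ a₂ a₃ b₁ b₂ z k

end

/-!
For `t = -6 v` with `v > 0`, the hypergeometric series is `3 v` times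
`S v = ∑ (1/2 + d v)_k / (1 + 4 v)_k / (k + 3 v)`, where `d = 1` for `C` and `d = 2` for `D`. The
shift `v ↦ v + 1` is creative telescoping: up to three initial terms, the difference of the
summands at `v` and `v + 1`, the latter weighted by `1/64` for `C` and by `-1/64` for `D`, is
exact, so `S v = h v ± S (v + 1) / 64` with `h` rational.

On the other side, `∑ Li_n(z) τ ^ n = z τ Φ(z, 1, 1 - τ)` for the Lerch transcendent
`Φ(z, 1, v) = ∑ z ^ k / (k + v)`, and dropping its first `m` terms shows that `Φ(z, 1, m v)`
satisfies a recurrence of the same kind with factor `z ^ m`. The arguments of the ladders are such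
that `z ^ m` is this same `±1/64`: `(-1/8)^2 = (-1/2)^6 = 1/64` and
`((1 ± i)/4)^4 = (-1/4)^3 = -1/64`. Both sides solve the same recurrence and stay bounded as
`v → ∞`, so they agree for all `v > 0`, and the identity theorem extends the equality from the
negative real axis to the disc.
-/

noncomputable section

open Filter Topology Finset Asymptotics ComplexConjugate

/-- The quotient `(a)_k / (b)_k` of two Pochhammer symbols. The product form makes the factors
visible; a vanishing factor `b + j` is inverted to `0`. -/
def pochRatio {K : Type*} [Field K] (a b : K) (k : ℕ) : K :=
  ∏ j ∈ range k, (a + j) / (b + j)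

section Field

variable {K : Type*} [Field K]

lemma pochRatio_succ (a b : K) (k : ℕ) :
    pochRatio a b (k + 1) = pochRatio a b k * ((a + k) / (b + k)) :=
  prod_range_succ _ k

lemma pochRatio_eq_ascPochhammer_div (a b : K) (k : ℕ) :
    pochRatio a b k = (ascPochhammer K k).eval a / (ascPochhammer K k).eval b := by
  induction k with
  | zero => simp [pochRatio]
  | succ k ih =>
    rw [pochRatio_succ, ih, ascPochhammer_succ_eval, ascPochhammer_succ_eval, div_mul_div_comm]

lemma pochRatio_self {a : K} (ha : ∀ j : ℕ, a + j ≠ 0) (k : ℕ) : pochRatio a a k = 1 :=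
  prod_eq_one fun j _ => div_self (ha j)

lemma pochRatio_self_add_one {s : K} (hs : ∀ j : ℕ, s + j ≠ 0) (k : ℕ) :
    pochRatio s (s + 1) k = s / (s + k) := by
  induction k with
  | zero => simpa [pochRatio] using (div_self (by simpa using hs 0)).symm
  | succ k ih =>
    rw [pochRatio_succ, ih, div_mul_div_comm, mul_comm (s + k), mul_div_mul_right _ _ (hs k)]
    push_cast
    rw [add_right_comm, add_assoc]

end Field

lemma ofReal_pochRatio (a b : ℝ) (k : ℕ) :
    ((pochRatio a b k : ℝ) : ℂ) = pochRatio (a : ℂ) (b : ℂ) k := by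
  simp [pochRatio]

section Decay

variable {𝕜 : Type*} [RCLike 𝕜]

lemma norm_one_add_le_exp (z : 𝕜) : ‖1 + z‖ ≤ Real.exp (RCLike.re z + ‖z‖ ^ 2 / 2) := by
  refine le_of_sq_le_sq ?_ (Real.exp_nonneg _)
  calc ‖1 + z‖ ^ 2 = 2 * RCLike.re z + ‖z‖ ^ 2 + 1 := by
        rw [norm_add_sq (𝕜 := 𝕜), norm_one, RCLike.inner_apply, map_one, mul_one]
        ring
    _ ≤ Real.exp (2 * RCLike.re z + ‖z‖ ^ 2) := Real.add_one_le_exp _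
    _ = Real.exp (RCLike.re z + ‖z‖ ^ 2 / 2) ^ 2 := by
        rw [← Real.exp_nat_mul]
        push_cast
        ring_nf

lemma exists_pos_mul_le_norm_add_natCast {b : 𝕜} (hb : ∀ j : ℕ, b + j ≠ 0) :
    ∃ m : ℝ, 0 < m ∧ ∀ j : ℕ, m * (j + 1) ≤ ‖b + j‖ := by
  have hlim : Tendsto (fun j : ℕ => ‖((1 : 𝕜) + 1 * j) / (b + 1 * j)‖) atTop (𝓝 ‖(1 : 𝕜) / 1‖) :=
    (tendsto_add_mul_div_add_mul_atTop_nhds 1 b 1 one_ne_zero).norm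
  obtain ⟨B, hB⟩ := hlim.bddAbove_range
  have hB' : ∀ j : ℕ, (j + 1 : ℝ) ≤ B * ‖b + j‖ := fun j => by
    have h := hB (Set.mem_range_self j)
    have hj : ‖(1 : 𝕜) + j‖ = j + 1 := by
      exact_mod_cast (RCLike.norm_natCast (K := 𝕜) (1 + j)).trans (congrArg Nat.cast (add_comm 1 j))
    simp only [one_mul, norm_div, hj] at h
    rwa [div_le_iff₀ (norm_pos_iff.2 (hb j))] at h
  have hB0 : 0 < B := pos_of_mul_pos_left (lt_of_lt_of_le (by simp) (hB' 0)) (norm_nonneg _)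
  exact ⟨B⁻¹, inv_pos.2 hB0, fun j => by rw [inv_mul_le_iff₀ hB0]; exact hB' j⟩

variable {a b : 𝕜} {M m : ℝ}

lemma norm_sub_div_add_natCast_le (hab : ‖b - a‖ ≤ M) (hm : 0 < m) {j : ℕ}
    (hj : m * (j + 1) ≤ ‖b + j‖) : ‖(a - b) / (b + j)‖ ≤ M / m * ((j : ℝ) + 1)⁻¹ := by
  have hM : 0 ≤ M := (norm_nonneg _).trans hab
  rw [norm_div, norm_sub_rev, ← div_eq_mul_inv, div_div]
  gcongr

lemma re_sub_div_add_natCast_le (hab : ‖b - a‖ ≤ M) (hb : ‖1 - b‖ ≤ M) (hm : 0 < m) {j : ℕ}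
    (hj : m * (j + 1) ≤ ‖b + j‖) :
    RCLike.re ((a - b) / (b + j)) ≤ -RCLike.re (b - a) * ((j : ℝ) + 1)⁻¹ +
      M ^ 2 / m * (((j : ℝ) + 1) ^ 2)⁻¹ := by
  have hj0 : 0 < (j : ℝ) + 1 := by positivity
  have hbj : b + j ≠ 0 := norm_pos_iff.1 ((mul_pos hm hj0).trans_le hj)
  have hj1 : (j : 𝕜) + 1 ≠ 0 := by exact_mod_cast j.succ_ne_zero
  have hM : 0 ≤ M := (norm_nonneg _).trans hb
  have hsplit : (a - b) / (b + j) = (((j : ℝ) + 1)⁻¹ : ℝ) * (a - b) +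
      (((j : ℝ) + 1)⁻¹ : ℝ) * ((1 - b) * ((a - b) / (b + j))) := by
    push_cast
    field_simp
    ring
  have herr : RCLike.re ((1 - b) * ((a - b) / (b + j))) ≤ M * (M / m * ((j : ℝ) + 1)⁻¹) := by
    refine (RCLike.re_le_norm _).trans ?_
    rw [norm_mul]
    gcongr
    exact norm_sub_div_add_natCast_le hab hm hj
  rw [hsplit, map_add, RCLike.re_ofReal_mul, RCLike.re_ofReal_mul]
  calc ((j : ℝ) + 1)⁻¹ * RCLike.re (a - b) +
        ((j : ℝ) + 1)⁻¹ * RCLike.re ((1 - b) * ((a - b) / (b + j)))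
      ≤ ((j : ℝ) + 1)⁻¹ * RCLike.re (a - b) +
        ((j : ℝ) + 1)⁻¹ * (M * (M / m * ((j : ℝ) + 1)⁻¹)) := by gcongr
    _ = _ := by
      rw [map_sub, map_sub]
      field_simp
      ring

lemma norm_add_div_add_le_exp (hab : ‖b - a‖ ≤ M) (hb : ‖1 - b‖ ≤ M) (hm : 0 < m) {j : ℕ}
    (hj : m * (j + 1) ≤ ‖b + j‖) :
    ‖(a + j) / (b + j)‖ ≤ Real.exp (-RCLike.re (b - a) * ((j : ℝ) + 1)⁻¹ +
      (M ^ 2 / m + (M / m) ^ 2 / 2) * (((j : ℝ) + 1) ^ 2)⁻¹) := by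
  have hbj : b + j ≠ 0 :=
    norm_pos_iff.1 ((mul_pos hm (by positivity : 0 < (j : ℝ) + 1)).trans_le hj)
  have hfactor : (a + j) / (b + j) = 1 + (a - b) / (b + j) := by
    field_simp
    ring
  have hnorm := norm_sub_div_add_natCast_le hab hm hj
  have hre := re_sub_div_add_natCast_le hab hb hm hj
  rw [hfactor]
  refine (norm_one_add_le_exp _).trans (Real.exp_le_exp.2 ?_)
  calc RCLike.re ((a - b) / (b + j)) + ‖(a - b) / (b + j)‖ ^ 2 / 2
      ≤ -RCLike.re (b - a) * ((j : ℝ) + 1)⁻¹ + M ^ 2 / m * (((j : ℝ) + 1) ^ 2)⁻¹ +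
        (M / m * ((j : ℝ) + 1)⁻¹) ^ 2 / 2 := by gcongr
    _ = _ := by
        rw [← inv_pow]
        ring

lemma abs_harmonic_sub_log_add_one_le (k : ℕ) : |(harmonic k : ℝ) - Real.log (k + 1)| ≤ 1 := by
  have hlow : Real.log (k + 1) ≤ harmonic k := by exact_mod_cast log_add_one_le_harmonic k
  have hmono : Real.log k ≤ Real.log (k + 1) := by
    rcases k.eq_zero_or_pos with rfl | hk
    · simp
    · exact Real.log_le_log (by exact_mod_cast hk) (by simp)
  rw [abs_le]
  constructor <;> linarith [harmonic_le_one_add_log k]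

lemma neg_mul_harmonic_le {r : ℝ} (hr : |r| ≤ M) (k : ℕ) :
    -r * harmonic k ≤ M + Real.log (k + 1) * -r := by
  have hM : 0 ≤ M := (abs_nonneg r).trans hr
  have hdiff : |r| * |(harmonic k : ℝ) - Real.log (k + 1)| ≤ M * 1 := by
    gcongr
    exact abs_harmonic_sub_log_add_one_le k
  rw [← abs_mul] at hdiff
  linarith [neg_abs_le (r * ((harmonic k : ℝ) - Real.log (k + 1)))]

/-- Uniformity of the constant in `a` and `b` is what makes the hypergeometric series converge
locally uniformly in its parameters. -/
lemma exists_norm_pochRatio_le (M : ℝ) (hm : 0 < m) :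
    ∃ C : ℝ, ∀ a b : 𝕜, ‖b - a‖ ≤ M → ‖1 - b‖ ≤ M → (∀ j : ℕ, m * (j + 1) ≤ ‖b + j‖) →
      ∀ k : ℕ, ‖pochRatio a b k‖ ≤ C * ((k : ℝ) + 1) ^ (-RCLike.re (b - a)) := by
  have hsum : Summable fun j : ℕ => (((j : ℝ) + 1) ^ 2)⁻¹ := by
    simpa using (summable_nat_add_iff 1).2 (Real.summable_nat_pow_inv.2 one_lt_two)
  set L := M ^ 2 / m + (M / m) ^ 2 / 2
  set S := ∑' j : ℕ, (((j : ℝ) + 1) ^ 2)⁻¹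
  refine ⟨Real.exp (M + L * S), fun a b hab hb hbj k => ?_⟩
  have hk : 0 < (k : ℝ) + 1 := by positivity
  set r := RCLike.re (b - a)
  have hharm : (harmonic k : ℝ) = ∑ j ∈ range k, ((j : ℝ) + 1)⁻¹ := by
    simp [harmonic]
  have hlead := neg_mul_harmonic_le ((RCLike.abs_re_le_norm (b - a)).trans hab) k
  calc ‖pochRatio a b k‖
      ≤ ∏ j ∈ range k, Real.exp (-r * ((j : ℝ) + 1)⁻¹ + L * (((j : ℝ) + 1) ^ 2)⁻¹) := by
        rw [pochRatio, norm_prod]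
        exact prod_le_prod (fun _ _ => norm_nonneg _) fun j _ =>
          norm_add_div_add_le_exp hab hb hm (hbj j)
    _ = Real.exp (-r * harmonic k + L * ∑ j ∈ range k, (((j : ℝ) + 1) ^ 2)⁻¹) := by
        rw [← Real.exp_sum, sum_add_distrib, ← mul_sum, ← mul_sum, hharm]
    _ ≤ Real.exp (M + Real.log (k + 1) * -r + L * S) := by
        gcongr
        exact hsum.sum_le_tsum _ fun j _ => by positivity
    _ = Real.exp (M + L * S) * ((k : ℝ) + 1) ^ (-r) := by
        rw [Real.rpow_def_of_pos hk, ← Real.exp_add]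
        ring_nf

lemma eventually_norm_pochRatio_le {X : Type*} [TopologicalSpace X] {a b : X → 𝕜} {x : X}
    (ha : ContinuousAt a x) (hb : ContinuousAt b x) (hbx : ∀ j : ℕ, b x + j ≠ 0) :
    ∃ C : ℝ, ∀ᶠ y in 𝓝 x, ∀ k : ℕ,
      ‖pochRatio (a y) (b y) k‖ ≤ C * ((k : ℝ) + 1) ^ (-RCLike.re (b y - a y)) := by
  obtain ⟨m, hm, hbm⟩ := exists_pos_mul_le_norm_add_natCast hbx
  set M := max ‖b x - a x‖ ‖1 - b x‖ + 1
  obtain ⟨C, hC⟩ := exists_norm_pochRatio_le (𝕜 := 𝕜) M (half_pos hm)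
  refine ⟨C, ?_⟩
  have hab_lt : ‖b x - a x‖ < M := lt_add_of_le_of_pos (le_max_left _ _) one_pos
  have hb_lt : ‖1 - b x‖ < M := lt_add_of_le_of_pos (le_max_right _ _) one_pos
  filter_upwards [(hb.sub ha).norm.eventually_lt_const hab_lt,
    (hb.const_sub 1).norm.eventually_lt_const hb_lt,
    hb.eventually (Metric.ball_mem_nhds _ (half_pos hm))] with y hy₁ hy₂ hy₃
  refine hC _ _ hy₁.le hy₂.le fun j => ?_
  have htri : ‖b x + j‖ ≤ ‖b y + j‖ + ‖b y - b x‖ := by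
    rw [norm_sub_rev, show b x + j = b y + j + (b x - b y) by ring]
    exact norm_add_le _ _
  have hy₃' : ‖b y - b x‖ < m / 2 := by simpa [dist_eq_norm] using hy₃
  have := hbm j
  have : 0 ≤ m * j := by positivity
  linarith

lemma tendsto_pochRatio_zero (hb : ∀ j : ℕ, b + j ≠ 0) (hab : RCLike.re a < RCLike.re b) :
    Tendsto (pochRatio a b) atTop (𝓝 0) := by
  obtain ⟨C, hC⟩ := eventually_norm_pochRatio_le (X := Unit) (x := ()) (a := fun _ => a)
    (b := fun _ => b) continuousAt_const continuousAt_const hb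
  refine squeeze_zero_norm hC.self_of_nhds ?_
  have hlim := (tendsto_rpow_neg_atTop (y := RCLike.re (b - a)) (by simpa using hab)).comp
    (tendsto_atTop_add_const_right _ 1 tendsto_natCast_atTop_atTop)
  simpa [Function.comp_def] using hlim.const_mul C

end Decay

section Hypergeometric

lemma hyp3F2Term_eq_mul (a₁ a₂ a₃ b₁ b₂ z : ℂ) (k : ℕ) :
    hyp3F2Term a₁ a₂ a₃ b₁ b₂ z k =
      pochRatio a₁ b₁ k * pochRatio a₂ b₂ k * pochRatio a₃ 1 k * z ^ k := by
  simp only [hyp3F2Term, pochRatio_eq_ascPochhammer_div, ascPochhammer_eval_one, div_mul_div_comm]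

lemma one_add_natCast_ne_zero (j : ℕ) : (1 : ℂ) + j ≠ 0 := by
  exact_mod_cast (Nat.succ_ne_zero j ∘ (add_comm j 1).trans)

lemma exists_eventually_norm_hyp3F2Term_one_le {X : Type*} [TopologicalSpace X]
    {a₁ a₂ a₃ b₁ b₂ : X → ℂ} {x : X} (ha₁ : ContinuousAt a₁ x) (ha₂ : ContinuousAt a₂ x)
    (ha₃ : ContinuousAt a₃ x) (hb₁ : ContinuousAt b₁ x) (hb₂ : ContinuousAt b₂ x)
    (hb₁x : ∀ j : ℕ, b₁ x + j ≠ 0) (hb₂x : ∀ j : ℕ, b₂ x + j ≠ 0) :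
    ∃ C : ℝ, ∀ᶠ y in 𝓝 x, ∀ k : ℕ, ‖hyp3F2Term (a₁ y) (a₂ y) (a₃ y) (b₁ y) (b₂ y) 1 k‖ ≤
      C * ((k : ℝ) + 1) ^ (-(1 + (b₁ y + b₂ y - a₁ y - a₂ y - a₃ y).re)) := by
  obtain ⟨C₁, hC₁⟩ := eventually_norm_pochRatio_le ha₁ hb₁ hb₁x
  obtain ⟨C₂, hC₂⟩ := eventually_norm_pochRatio_le ha₂ hb₂ hb₂x
  obtain ⟨C₃, hC₃⟩ := eventually_norm_pochRatio_le ha₃ (continuousAt_const (y := (1 : ℂ)))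
    one_add_natCast_ne_zero
  refine ⟨C₁ * C₂ * C₃, ?_⟩
  filter_upwards [hC₁, hC₂, hC₃] with y h₁ h₂ h₃ k
  have hk : 0 < (k : ℝ) + 1 := by positivity
  rw [hyp3F2Term_eq_mul, one_pow, mul_one, norm_mul, norm_mul]
  calc _ ≤ _ := mul_le_mul (mul_le_mul (h₁ k) (h₂ k) (norm_nonneg _) ((norm_nonneg _).trans (h₁ k)))
        (h₃ k) (norm_nonneg _) (mul_nonneg ((norm_nonneg _).trans (h₁ k))
          ((norm_nonneg _).trans (h₂ k)))
    _ = C₁ * C₂ * C₃ * ((k : ℝ) + 1) ^ (-(b₁ y - a₁ y).re + -(b₂ y - a₂ y).re +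
          -(1 - a₃ y).re) := by
        rw [Real.rpow_add hk, Real.rpow_add hk]
        simp only [RCLike.re_to_complex]
        ring
    _ = _ := by
        congr 2
        simp only [Complex.sub_re, Complex.add_re, Complex.one_re]
        ring

lemma summable_natCast_add_one_rpow_neg {δ : ℝ} (hδ : 0 < δ) :
    Summable fun k : ℕ => ((k : ℝ) + 1) ^ (-(1 + δ)) := by
  simpa using (summable_nat_add_iff 1).2
    (Real.summable_nat_rpow.2 (show -(1 + δ) < -1 by linarith))

lemma summable_hyp3F2Term_one {a₁ a₂ a₃ b₁ b₂ : ℂ} (hb₁ : ∀ j : ℕ, b₁ + j ≠ 0)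
    (hb₂ : ∀ j : ℕ, b₂ + j ≠ 0) (h : 0 < (b₁ + b₂ - a₁ - a₂ - a₃).re) :
    Summable (hyp3F2Term a₁ a₂ a₃ b₁ b₂ 1) := by
  obtain ⟨C, hC⟩ := exists_eventually_norm_hyp3F2Term_one_le (X := Unit) (x := ())
    (continuousAt_const (y := a₁)) (continuousAt_const (y := a₂)) (continuousAt_const (y := a₃))
    (continuousAt_const (y := b₁)) (continuousAt_const (y := b₂)) hb₁ hb₂
  exact .of_norm_bounded ((summable_natCast_add_one_rpow_neg h).mul_left C) hC.self_of_nhds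

lemma differentiableOn_pochRatio {a b : ℂ → ℂ} {U : Set ℂ} (ha : DifferentiableOn ℂ a U)
    (hb : DifferentiableOn ℂ b U) (hbU : ∀ t ∈ U, ∀ j : ℕ, b t + j ≠ 0) (k : ℕ) :
    DifferentiableOn ℂ (fun t => pochRatio (a t) (b t) k) U := by
  unfold pochRatio
  exact DifferentiableOn.fun_finsetProd fun j _ =>
    (ha.add_const _).div (hb.add_const _) fun t ht => hbU t ht j

lemma differentiableOn_hyp3F2_one {a₁ a₂ a₃ b₁ b₂ : ℂ → ℂ} {U : Set ℂ} (hU : IsOpen U)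
    (ha₁ : DifferentiableOn ℂ a₁ U) (ha₂ : DifferentiableOn ℂ a₂ U)
    (ha₃ : DifferentiableOn ℂ a₃ U) (hb₁ : DifferentiableOn ℂ b₁ U)
    (hb₂ : DifferentiableOn ℂ b₂ U) (hb₁U : ∀ t ∈ U, ∀ j : ℕ, b₁ t + j ≠ 0)
    (hb₂U : ∀ t ∈ U, ∀ j : ℕ, b₂ t + j ≠ 0)
    (h : ∀ t ∈ U, 0 < (b₁ t + b₂ t - a₁ t - a₂ t - a₃ t).re) :
    DifferentiableOn ℂ (fun t => hyp3F2 (a₁ t) (a₂ t) (a₃ t) (b₁ t) (b₂ t) 1) U := by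
  intro t ht
  have hcont {f : ℂ → ℂ} (hf : DifferentiableOn ℂ f U) : ContinuousAt f t :=
    hf.continuousOn.continuousAt (hU.mem_nhds ht)
  set excess : ℂ → ℝ := fun y => (b₁ y + b₂ y - a₁ y - a₂ y - a₃ y).re
  have hexcess : ∀ᶠ y in 𝓝 t, excess t / 2 < excess y :=
    (Complex.continuous_re.continuousAt.comp (((((hcont hb₁).add (hcont hb₂)).sub
      (hcont ha₁)).sub (hcont ha₂)).sub (hcont ha₃))).eventually_const_lt (half_lt_self (h t ht))
  obtain ⟨C, hC⟩ := exists_eventually_norm_hyp3F2Term_one_le (hcont ha₁) (hcont ha₂) (hcont ha₃)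
    (hcont hb₁) (hcont hb₂) (hb₁U t ht) (hb₂U t ht)
  obtain ⟨V, hV, hVo, htV⟩ := eventually_nhds_iff.1 ((hexcess.and hC).and (hU.mem_nhds ht))
  have hVU : V ⊆ U := fun y hy => (hV y hy).2
  refine (DifferentiableOn.differentiableAt ?_ (hVo.mem_nhds htV)).differentiableWithinAt
  refine Complex.differentiableOn_tsum_of_summable_norm
    ((summable_natCast_add_one_rpow_neg (half_pos (h t ht))).mul_left |C|) (fun k => ?_) hVo
    fun k y hy => ?_
  · simp only [hyp3F2Term_eq_mul, one_pow, mul_one]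
    exact (((differentiableOn_pochRatio ha₁ hb₁ hb₁U k).mul
      (differentiableOn_pochRatio ha₂ hb₂ hb₂U k)).mul
      (differentiableOn_pochRatio ha₃ (differentiableOn_const 1)
        (fun _ _ => one_add_natCast_ne_zero) k)).mono hVU
  · obtain ⟨⟨hy_excess, hy_norm⟩, -⟩ := hV y hy
    refine (hy_norm k).trans (mul_le_mul (le_abs_self C) ?_ (by positivity) (abs_nonneg C))
    exact Real.rpow_le_rpow_of_exponent_le (by simp) (neg_le_neg (by gcongr))

lemma add_natCast_ne_zero_of_re_pos {b : ℂ} (hb : 0 < b.re) (j : ℕ) : b + j ≠ 0 := by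
  intro h
  have := congrArg Complex.re h
  simp only [Complex.add_re, Complex.natCast_re, Complex.zero_re] at this
  linarith [j.cast_nonneg (α := ℝ)]

lemma hyp3F2Term_self_add_one {s : ℂ} (hs : ∀ j : ℕ, s + j ≠ 0) (a b : ℂ) (k : ℕ) :
    hyp3F2Term s a 1 (s + 1) b 1 k = s * (pochRatio a b k / (s + k)) := by
  rw [hyp3F2Term_eq_mul, pochRatio_self_add_one hs, pochRatio_self one_add_natCast_ne_zero]
  ring

end Hypergeometric

section Recurrence

lemma tsum_eq_of_telescope {M : Type*} [AddCommGroup M] [TopologicalSpace M]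
    [IsTopologicalAddGroup M] [T2Space M] {r r' G : ℕ → M} (N : ℕ) (hr : Summable r)
    (hr' : Summable r') (hG : Tendsto G atTop (𝓝 0))
    (h : ∀ j, r (j + N) - r' j = G (j + 1) - G j) :
    ∑' k, r k = ∑ k ∈ range N, r k - G 0 + ∑' k, r' k := by
  have htail : ∑' j, r (j + N) - ∑' j, r' j = 0 - G 0 := by
    have hsum := (((summable_nat_add_iff N).2 hr).hasSum.sub hr'.hasSum).tendsto_sum_nat
    simp only [h, sum_range_sub] at hsum
    exact tendsto_nhds_unique hsum (hG.sub_const (G 0))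
  rw [← hr.sum_add_tsum_nat_add N, sub_eq_iff_eq_add.1 htail]
  abel

lemma eq_of_eq_add_smul_shift {𝕜 E : Type*} [NormedField 𝕜] [NormedAddCommGroup E]
    [NormedSpace 𝕜 E] {f g h : ℝ → E} {c : 𝕜} (hc : ‖c‖ < 1)
    (hf : ∀ x, 0 < x → f x = h x + c • f (x + 1)) (hg : ∀ x, 0 < x → g x = h x + c • g (x + 1))
    (hfg : (f - g) =O[atTop] (fun _ => 1 : ℝ → ℝ)) {x : ℝ} (hx : 0 < x) : f x = g x := by
  have hiter (n : ℕ) : (f - g) x = c ^ n • (f - g) (x + n) := by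
    induction n with
    | zero => simp
    | succ n ih =>
      have hxn : 0 < x + n := by positivity
      rw [ih, Pi.sub_apply, hf _ hxn, hg _ hxn, add_sub_add_left_eq_sub, ← smul_sub, smul_smul,
        pow_succ, Nat.cast_succ, add_assoc, Pi.sub_apply]
  have hbdd := (isBigO_one_iff ℝ).1 (hfg.comp_tendsto
    (tendsto_atTop_add_const_left _ x tendsto_natCast_atTop_atTop))
  have hlim := (tendsto_pow_atTop_nhds_zero_of_norm_lt_one hc).zero_smul_isBoundedUnder_le hbdd
  exact sub_eq_zero.1 (tendsto_nhds_unique (tendsto_const_nhds.congr hiter) hlim)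

end Recurrence

/-- The Lerch transcendent `Φ(z, 1, v) = ∑ z ^ k / (k + v)` at `s = 1`. It generates the values
`Li_n(z)` for all `n` simultaneously, see `hasSum_polyLi_mul_pow`. -/
def lerchPhi (z v : ℂ) : ℂ :=
  ∑' k : ℕ, z ^ k / (k + v)

section Lerch

variable {z v : ℂ}

lemma norm_pow_div_natCast_add_le (z : ℂ) (hv : 0 < v.re) (k : ℕ) :
    ‖z ^ k / (k + v)‖ ≤ ‖z‖ ^ k / v.re := by
  have hre : v.re ≤ ‖(k : ℂ) + v‖ := by
    refine le_trans ?_ (Complex.re_le_norm _)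
    rw [Complex.add_re, Complex.natCast_re]
    exact le_add_of_nonneg_left k.cast_nonneg
  rw [norm_div, norm_pow]
  gcongr

lemma hasSum_norm_pow_div (hz : ‖z‖ < 1) (x : ℝ) :
    HasSum (fun k : ℕ => ‖z‖ ^ k / x) ((1 - ‖z‖)⁻¹ / x) :=
  (hasSum_geometric_of_lt_one (norm_nonneg z) hz).div_const x

lemma summable_pow_div_natCast_add (hz : ‖z‖ < 1) (hv : 0 < v.re) :
    Summable fun k : ℕ => z ^ k / (k + v) :=
  .of_norm_bounded (hasSum_norm_pow_div hz v.re).summable (norm_pow_div_natCast_add_le z hv)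

lemma norm_lerchPhi_le (hz : ‖z‖ < 1) (hv : 0 < v.re) :
    ‖lerchPhi z v‖ ≤ (1 - ‖z‖)⁻¹ / v.re :=
  tsum_of_norm_bounded (hasSum_norm_pow_div hz v.re) (norm_pow_div_natCast_add_le z hv)

lemma isBigO_lerchPhi_mul (hz : ‖z‖ < 1) {c : ℝ} (hc : 0 < c) :
    (fun x : ℝ => lerchPhi z (c * x)) =O[atTop] (fun _ => 1 : ℝ → ℝ) := by
  refine .of_bound ((1 - ‖z‖)⁻¹ / c) ?_
  filter_upwards [eventually_ge_atTop 1] with x hx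
  have hcx : c ≤ ((c : ℂ) * x).re := by
    simpa using le_mul_of_one_le_right hc.le hx
  have : 0 ≤ (1 - ‖z‖)⁻¹ := inv_nonneg.2 (sub_nonneg.2 hz.le)
  calc ‖lerchPhi z (c * x)‖ ≤ (1 - ‖z‖)⁻¹ / ((c : ℂ) * x).re :=
        norm_lerchPhi_le hz (hc.trans_le hcx)
    _ ≤ (1 - ‖z‖)⁻¹ / c := by gcongr
    _ = (1 - ‖z‖)⁻¹ / c * ‖(1 : ℝ)‖ := by simp

lemma lerchPhi_shift (hz : ‖z‖ < 1) (hv : 0 < v.re) (N : ℕ) :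
    lerchPhi z v = ∑ k ∈ range N, z ^ k / (k + v) + z ^ N * lerchPhi z (v + N) := by
  rw [lerchPhi, ← (summable_pow_div_natCast_add hz hv).sum_add_tsum_nat_add N, lerchPhi,
    ← tsum_mul_left]
  congr 2
  ext k
  push_cast
  ring

lemma differentiableOn_lerchPhi (hz : ‖z‖ < 1) :
    DifferentiableOn ℂ (lerchPhi z) {v | 0 < v.re} := by
  intro v (hv : 0 < v.re)
  have hhalf : 0 < v.re / 2 := half_pos hv
  have hopen : IsOpen {w : ℂ | v.re / 2 < w.re} := isOpen_lt continuous_const Complex.continuous_re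
  refine (DifferentiableOn.differentiableAt ?_
    (hopen.mem_nhds (Set.mem_ofPred.2 (half_lt_self hv)))).differentiableWithinAt
  refine Complex.differentiableOn_tsum_of_summable_norm
    (hasSum_norm_pow_div hz (v.re / 2)).summable (fun k => ?_) hopen fun k w hw => ?_
  · refine (differentiableOn_const _).div (by fun_prop) fun w hw => ?_
    rw [add_comm]
    exact add_natCast_ne_zero_of_re_pos (hhalf.trans hw) k
  · refine (norm_pow_div_natCast_add_le z (hhalf.trans hw) k).trans ?_
    gcongr
    exact hw.le

end Lerch

/-- The summand of the hypergeometric series at `t = -6 v`, divided by `3 v`; the series of `C`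
and `D` are the cases `d = 1` and `d = 2`. -/
def ladderTerm (d v : ℝ) (k : ℕ) : ℝ :=
  pochRatio (1 / 2 + d * v) (1 + 4 * v) k / (k + 3 * v)

section LadderTerm

variable {d v : ℝ}

lemma hyp3F2Term_neg_six_mul (d : ℝ) (hv : 0 < v) (k : ℕ) :
    hyp3F2Term (3 * v) (1 / 2 + d * v) 1 (3 * v + 1) (1 + 4 * v) 1 k =
      3 * v * (ladderTerm d v k : ℂ) := by
  rw [hyp3F2Term_self_add_one (add_natCast_ne_zero_of_re_pos (by simpa using hv)), ladderTerm,
    add_comm (3 * (v : ℂ))]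
  push_cast [ofReal_pochRatio]
  rfl

lemma hyp3F2_neg_six_mul (d : ℝ) (hv : 0 < v) :
    hyp3F2 (3 * v) (1 / 2 + d * v) 1 (3 * v + 1) (1 + 4 * v) 1 =
      3 * v * ((∑' k, ladderTerm d v k : ℝ) : ℂ) := by
  rw [hyp3F2, Complex.ofReal_tsum, ← tsum_mul_left]
  exact tsum_congr (hyp3F2Term_neg_six_mul d hv)

lemma summable_ladderTerm (hd : d ≤ 4) (hv : 0 < v) : Summable (ladderTerm d v) := by
  have hexcess : (3 * v + 1 + (1 + 4 * v) - 3 * v - (1 / 2 + d * v) - 1 : ℂ) =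
      (1 / 2 + (4 - d) * v : ℝ) := by
    push_cast
    ring
  have hsum : Summable (hyp3F2Term (3 * v) (1 / 2 + d * v) 1 (3 * v + 1) (1 + 4 * v) 1) := by
    refine summable_hyp3F2Term_one (add_natCast_ne_zero_of_re_pos (by simpa using by positivity))
      (add_natCast_ne_zero_of_re_pos (by simpa using by positivity)) ?_
    rw [hexcess, Complex.ofReal_re]
    have := mul_nonneg (sub_nonneg.2 hd) hv.le
    positivity
  rw [funext (hyp3F2Term_neg_six_mul d hv)] at hsum
  exact Complex.summable_ofReal.1 ((summable_mul_left_iff (by simpa using hv.ne')).1 hsum)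

lemma ladderTerm_nonneg (hd : 0 ≤ d) (hv : 0 < v) (k : ℕ) : 0 ≤ ladderTerm d v k :=
  div_nonneg (prod_nonneg fun _ _ => by positivity) (by positivity)

lemma antitoneOn_ladderTerm (hd₀ : 0 ≤ d) (hd : d ≤ 2) (k : ℕ) :
    AntitoneOn (fun v => ladderTerm d v k) (Set.Ioi 0) := by
  intro v (hv : 0 < v) w (hw : 0 < w) hvw
  have hfactor (j : ℕ) : (1 / 2 + d * w + j) / (1 + 4 * w + j) ≤
      (1 / 2 + d * v + j) / (1 + 4 * v + j) := by
    rw [div_le_div_iff₀ (by positivity) (by positivity)]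
    nlinarith [mul_nonneg (sub_nonneg.2 hvw) (sub_nonneg.2 hd),
      mul_nonneg (mul_nonneg (sub_nonneg.2 hvw) (sub_nonneg.2 hd)) j.cast_nonneg,
      mul_nonneg (sub_nonneg.2 hvw) (j.cast_nonneg (α := ℝ))]
  exact div_le_div₀ (prod_nonneg fun _ _ => by positivity)
    (prod_le_prod (fun _ _ => by positivity) fun j _ => hfactor j) (by positivity) (by linarith)

lemma isBigO_tsum_ladderTerm (hd₀ : 0 ≤ d) (hd : d ≤ 2) :
    (fun v => ((∑' k, ladderTerm d v k : ℝ) : ℂ)) =O[atTop] (fun _ => 1 : ℝ → ℝ) := by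
  refine .of_bound (∑' k, ladderTerm d 1 k) ?_
  filter_upwards [eventually_ge_atTop 1] with v hv
  have hv0 : 0 < v := one_pos.trans_le hv
  rw [Complex.norm_real, Real.norm_of_nonneg (tsum_nonneg (ladderTerm_nonneg hd₀ hv0)),
    norm_one, mul_one]
  exact (summable_ladderTerm (by linarith) hv0).tsum_le_tsum
    (fun k => antitoneOn_ladderTerm hd₀ hd k (Set.mem_Ioi.2 one_pos) hv0 hv)
    (summable_ladderTerm (by linarith) one_pos)

end LadderTerm

section Telescoping

variable {v : ℝ}

lemma pochRatio_add_one_add_four {a b : ℝ} (ha : 0 < a) (hb : 0 < b) (j : ℕ) :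
    pochRatio (a + 1) (b + 4) j = pochRatio a b (j + 3) * (b * (b + 1) * (b + 2) * (b + 3)) /
      (a * (a + j + 1) * (a + j + 2) * (b + j + 3)) := by
  induction j with
  | zero =>
    simp only [pochRatio, prod_range_succ, prod_range_zero]
    push_cast
    field_simp
    ring
  | succ j ih =>
    rw [pochRatio_succ, ih, add_right_comm j 1 3, pochRatio_succ a b (j + 3)]
    push_cast
    field_simp
    ring

lemma pochRatio_add_two_add_four {a b : ℝ} (ha : 0 < a) (hb : 0 < b) (j : ℕ) :
    pochRatio (a + 2) (b + 4) j = pochRatio a b (j + 3) * (b * (b + 1) * (b + 2) * (b + 3)) /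
      (a * (a + 1) * (a + j + 2) * (b + j + 3)) := by
  induction j with
  | zero =>
    simp only [pochRatio, prod_range_succ, prod_range_zero]
    push_cast
    field_simp
    ring
  | succ j ih =>
    rw [pochRatio_succ, ih, add_right_comm j 1 3, pochRatio_succ a b (j + 3)]
    push_cast
    field_simp
    ring

/-- The certificate of the shift `v ↦ v + 1` for `ladderTerm 1`: its forward difference in `j` is
`ladderTerm 1 v (j + 3) - ladderTerm 1 (v + 1) j / 64`. The rational factor was found by solving
for the coefficients of its numerator. -/
def certificateC (v : ℝ) (j : ℕ) : ℝ :=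
  pochRatio (1 / 2 + v) (1 + 4 * v) (j + 3) *
    ((-2 / (6 * v + 1) * (j + (3 + 3 * v)) ^ 2 +
      2 * (18 * v ^ 2 + 17 * v + 5) / ((6 * v + 1) * (6 * v + 3)) * (j + (3 + 3 * v)) -
      (20 * v ^ 2 + 20 * v + 9) / (2 * (6 * v + 1) * (6 * v + 3) * (6 * v + 5))) /
    ((j + (3 / 2 + v)) * (j + (5 / 2 + v))))

/-- The certificate of the shift `v ↦ v + 1` for `ladderTerm 2`: its forward difference in `j` is
`ladderTerm 2 v (j + 3) + ladderTerm 2 (v + 1) j / 64`. -/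
def certificateD (v : ℝ) (j : ℕ) : ℝ :=
  pochRatio (1 / 2 + 2 * v) (1 + 4 * v) (j + 3) *
    ((-2 / (4 * v + 1) * (j + (3 + 3 * v)) + 1 / ((4 * v + 1) * (4 * v + 3))) /
    (j + (5 / 2 + 2 * v)))

lemma certificateC_succ_sub (hv : 0 < v) (j : ℕ) :
    ladderTerm 1 v (j + 3) - 1 / 64 * ladderTerm 1 (v + 1) j =
      certificateC v (j + 1) - certificateC v j := by
  have hshift := pochRatio_add_one_add_four (a := 1 / 2 + v) (b := 1 + 4 * v) (by positivity)
    (by positivity) j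
  rw [ladderTerm, ladderTerm, one_mul, one_mul, ← add_assoc, show 1 + 4 * (v + 1) =
    1 + 4 * v + 4 by ring, hshift, certificateC, certificateC, add_right_comm j 1 3,
    pochRatio_succ _ _ (j + 3)]
  push_cast
  field_simp
  ring

lemma certificateD_succ_sub (hv : 0 < v) (j : ℕ) :
    ladderTerm 2 v (j + 3) - -1 / 64 * ladderTerm 2 (v + 1) j =
      certificateD v (j + 1) - certificateD v j := by
  have hshift := pochRatio_add_two_add_four (a := 1 / 2 + 2 * v) (b := 1 + 4 * v) (by positivity)
    (by positivity) j
  rw [ladderTerm, ladderTerm, show 1 / 2 + 2 * (v + 1) = 1 / 2 + 2 * v + 2 by ring,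
    show 1 + 4 * (v + 1) = 1 + 4 * v + 4 by ring, hshift, certificateD, certificateD,
    add_right_comm j 1 3, pochRatio_succ _ _ (j + 3)]
  push_cast
  field_simp
  ring

lemma tendsto_linear_div_natCast_add (p q α β : ℝ) :
    Tendsto (fun j : ℕ => (p * (j + α) + q) / (j + β)) atTop (𝓝 p) := by
  have hlim := tendsto_add_mul_div_add_mul_atTop_nhds (p * α + q) β p one_ne_zero
  rw [div_one] at hlim
  refine hlim.congr fun j => ?_
  ring_nf

lemma tendsto_quadratic_div_natCast_add (p q r α β γ : ℝ) :
    Tendsto (fun j : ℕ => (p * (j + α) ^ 2 + q * (j + α) - r) / ((j + β) * (j + γ))) atTop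
      (𝓝 p) := by
  have hinv := tendsto_linear_div_natCast_add 0 1 0 γ
  have hlim := ((tendsto_linear_div_natCast_add p q α β).mul
    (tendsto_linear_div_natCast_add 1 0 α γ)).add
    ((tendsto_linear_div_natCast_add 0 (-r) 0 β).mul hinv)
  simp only [mul_one, mul_zero, add_zero] at hlim
  refine hlim.congr fun j => ?_
  rw [div_mul_div_comm, div_mul_div_comm, ← add_div]
  ring_nf

lemma tendsto_certificateC (hv : 0 < v) : Tendsto (certificateC v) atTop (𝓝 0) := by
  have hpoch : Tendsto (pochRatio (1 / 2 + v) (1 + 4 * v)) atTop (𝓝 0) :=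
    tendsto_pochRatio_zero (fun j => by positivity) (by
      simp only [RCLike.re_to_real]
      linarith)
  rw [← zero_mul (-2 / (6 * v + 1))]
  exact ((tendsto_add_atTop_iff_nat 3).2 hpoch).mul (tendsto_quadratic_div_natCast_add ..)

lemma tendsto_certificateD (hv : 0 < v) : Tendsto (certificateD v) atTop (𝓝 0) := by
  have hpoch : Tendsto (pochRatio (1 / 2 + 2 * v) (1 + 4 * v)) atTop (𝓝 0) :=
    tendsto_pochRatio_zero (fun j => by positivity) (by
      simp only [RCLike.re_to_real]
      linarith)
  rw [← zero_mul (-2 / (4 * v + 1))]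
  exact ((tendsto_add_atTop_iff_nat 3).2 hpoch).mul (tendsto_linear_div_natCast_add ..)

lemma tsum_ladderTerm_one_shift (hv : 0 < v) :
    ∑' k, ladderTerm 1 v k = 2 * ∑ k ∈ range 2, (-1 / 8) ^ k / (k + 2 * v)
      - 4 * ∑ k ∈ range 6, (-1 / 2) ^ k / (k + 6 * v) + 1 / 64 * ∑' k, ladderTerm 1 (v + 1) k := by
  rw [tsum_eq_of_telescope 3 (summable_ladderTerm (by norm_num) hv)
    ((summable_ladderTerm (by norm_num) (by positivity)).mul_left _) (tendsto_certificateC hv)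
    (certificateC_succ_sub hv), tsum_mul_left]
  congr 1
  simp only [ladderTerm, certificateC, pochRatio, sum_range_succ, prod_range_succ,
    prod_range_zero, sum_range_zero]
  push_cast
  field_simp
  ring

lemma tsum_ladderTerm_two_shift (hv : 0 < v) :
    ∑' k, ladderTerm 2 v k = 2 * (2 / (4 * v) + 1 / 2 / (1 + 4 * v) - 1 / 16 / (3 + 4 * v))
      - 2 * ∑ k ∈ range 3, (-1 / 4) ^ k / (k + 3 * v) + -1 / 64 * ∑' k, ladderTerm 2 (v + 1) k := by
  rw [tsum_eq_of_telescope 3 (summable_ladderTerm (by norm_num) hv)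
    ((summable_ladderTerm (by norm_num) (by positivity)).mul_left _) (tendsto_certificateD hv)
    (certificateD_succ_sub hv), tsum_mul_left]
  congr 1
  simp only [ladderTerm, certificateD, pochRatio, sum_range_succ, prod_range_succ,
    prod_range_zero, sum_range_zero]
  push_cast
  field_simp
  ring

end Telescoping

section LerchEvaluation

lemma lerchPhi_natCast_mul_shift {z : ℂ} (hz : ‖z‖ < 1) {m : ℕ} (hm : 0 < m) {v : ℝ} (hv : 0 < v) :
    lerchPhi z (m * v) = ∑ k ∈ range m, z ^ k / (k + m * v) +
      z ^ m * lerchPhi z (m * (v + 1 : ℝ)) := by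
  have hre : 0 < ((m : ℂ) * v).re := by simpa using by positivity
  rw [lerchPhi_shift hz hre m]
  push_cast
  rw [mul_add, mul_one]

lemma tsum_ladderTerm_one {v : ℝ} (hv : 0 < v) :
    ((∑' k, ladderTerm 1 v k : ℝ) : ℂ) =
      2 * lerchPhi (-1 / 8) (2 * v) - 4 * lerchPhi (-1 / 2) (6 * v) := by
  have h8 : ‖(-1 / 8 : ℂ)‖ < 1 := by norm_num
  have h2 : ‖(-1 / 2 : ℂ)‖ < 1 := by norm_num
  refine eq_of_eq_add_smul_shift (c := (1 / 64 : ℂ))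
    (f := fun v => ((∑' k, ladderTerm 1 v k : ℝ) : ℂ))
    (g := fun v => 2 * lerchPhi (-1 / 8) (2 * v) - 4 * lerchPhi (-1 / 2) (6 * v))
    (h := fun v => 2 * ∑ k ∈ range 2, (-1 / 8) ^ k / (k + 2 * (v : ℂ)) -
      4 * ∑ k ∈ range 6, (-1 / 2) ^ k / (k + 6 * (v : ℂ)))
    (by norm_num) (fun x hx => ?_) (fun x hx => ?_) ?_ hv
  · simp only [tsum_ladderTerm_one_shift hx, smul_eq_mul]
    push_cast
    rfl
  · have shift8 := lerchPhi_natCast_mul_shift h8 two_pos hx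
    have shift2 := lerchPhi_natCast_mul_shift h2 (m := 6) (by norm_num) hx
    simp only [Nat.cast_ofNat] at shift8 shift2
    rw [shift8, shift2, smul_eq_mul]
    ring
  · exact (isBigO_tsum_ladderTerm zero_le_one one_le_two).sub
      (((isBigO_lerchPhi_mul h8 two_pos).const_mul_left 2).sub
        ((isBigO_lerchPhi_mul h2 (c := 6) (by norm_num)).const_mul_left 4))

lemma norm_one_add_I_div_four_lt_one : ‖(1 + Complex.I) / 4‖ < 1 := by
  have htri := norm_add_le (1 : ℂ) Complex.I
  rw [norm_one, Complex.norm_I] at htri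
  rw [norm_div, Complex.norm_ofNat]
  linarith

lemma norm_conj_one_add_I_div_four_lt_one : ‖conj ((1 + Complex.I) / 4)‖ < 1 := by
  rw [RCLike.norm_conj]
  exact norm_one_add_I_div_four_lt_one

lemma one_add_I_div_four_pow_four : ((1 + Complex.I) / 4) ^ 4 = -1 / 64 := by
  linear_combination (Complex.I ^ 2 + 4 * Complex.I + 5) / 256 * Complex.I_sq

lemma conj_one_add_I_div_four_pow_four : (conj ((1 + Complex.I) / 4)) ^ 4 = -1 / 64 := by
  rw [← map_pow, one_add_I_div_four_pow_four, map_div₀, map_neg, map_one, map_ofNat]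

lemma sum_range_four_one_add_I_pow_div_add_conj (x : ℂ) :
    ∑ k ∈ range 4, ((1 + Complex.I) / 4) ^ k / (k + x) +
      ∑ k ∈ range 4, (conj ((1 + Complex.I) / 4)) ^ k / (k + x) =
    2 / x + 1 / 2 / (1 + x) - 1 / 16 / (3 + x) := by
  have hconj : conj ((1 + Complex.I) / 4) = (1 - Complex.I) / 4 := by
    simp [map_div₀, map_ofNat, sub_eq_add_neg]
  have hsq : ((1 + Complex.I) / 4) ^ 2 + ((1 - Complex.I) / 4) ^ 2 = 0 := by
    linear_combination 1 / 8 * Complex.I_sq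
  have hcube : ((1 + Complex.I) / 4) ^ 3 + ((1 - Complex.I) / 4) ^ 3 = -1 / 16 := by
    linear_combination 3 / 32 * Complex.I_sq
  simp only [hconj, sum_range_succ, sum_range_zero]
  push_cast
  linear_combination (2 + x)⁻¹ * hsq + (3 + x)⁻¹ * hcube

lemma tsum_ladderTerm_two {v : ℝ} (hv : 0 < v) :
    ((∑' k, ladderTerm 2 v k : ℝ) : ℂ) =
      2 * (lerchPhi ((1 + Complex.I) / 4) (4 * v) +
        lerchPhi (conj ((1 + Complex.I) / 4)) (4 * v)) - 2 * lerchPhi (-1 / 4) (3 * v) := by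
  have hpow := one_add_I_div_four_pow_four
  have hpow' := conj_one_add_I_div_four_pow_four
  have hsum (x : ℝ) := sum_range_four_one_add_I_pow_div_add_conj (4 * x)
  have hz := norm_one_add_I_div_four_lt_one
  have hz' := norm_conj_one_add_I_div_four_lt_one
  have h4 : ‖(-1 / 4 : ℂ)‖ < 1 := by norm_num
  generalize (1 + Complex.I) / 4 = z at *
  refine eq_of_eq_add_smul_shift (c := (-1 / 64 : ℂ))
    (f := fun v => ((∑' k, ladderTerm 2 v k : ℝ) : ℂ))
    (g := fun v => 2 * (lerchPhi z (4 * v) + lerchPhi (conj z) (4 * v)) -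
      2 * lerchPhi (-1 / 4) (3 * v))
    (h := fun v => 2 * (2 / (4 * v) + 1 / 2 / (1 + 4 * v) - 1 / 16 / (3 + 4 * v)) -
      2 * ∑ k ∈ range 3, (-1 / 4) ^ k / (k + 3 * (v : ℂ)))
    (by norm_num) (fun x hx => ?_) (fun x hx => ?_) ?_ hv
  · simp only [tsum_ladderTerm_two_shift hx, smul_eq_mul]
    push_cast
    rfl
  · have shift := lerchPhi_natCast_mul_shift hz (m := 4) (by norm_num) hx
    have shift' := lerchPhi_natCast_mul_shift hz' (m := 4) (by norm_num) hx
    have shift4 := lerchPhi_natCast_mul_shift h4 (m := 3) (by norm_num) hx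
    simp only [Nat.cast_ofNat, hpow, hpow'] at shift shift' shift4
    rw [shift, shift', shift4, smul_eq_mul, ← hsum]
    ring
  · exact (isBigO_tsum_ladderTerm zero_le_two le_rfl).sub
      ((((isBigO_lerchPhi_mul hz (c := 4) (by norm_num)).add
        (isBigO_lerchPhi_mul hz' (c := 4) (by norm_num))).const_mul_left 2).sub
        ((isBigO_lerchPhi_mul h4 (c := 3) (by norm_num)).const_mul_left 2))

end LerchEvaluation

section GeneratingFunction

variable {z τ : ℂ}

lemma norm_natCast_add_one (k : ℕ) : ‖(k : ℂ) + 1‖ = k + 1 := by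
  exact_mod_cast Complex.norm_natCast (k + 1)

lemma summable_polyLi (hz : ‖z‖ < 1) (n : ℕ) :
    Summable fun k : ℕ => z ^ (k + 1) / ((k : ℂ) + 1) ^ n := by
  refine .of_norm_bounded ((summable_nat_add_iff 1).2
    (summable_geometric_of_lt_one (norm_nonneg z) hz)) fun k => ?_
  rw [norm_div, norm_pow, norm_pow, norm_natCast_add_one]
  exact div_le_self (by positivity) (one_le_pow₀ (by simp))

lemma summable_pow_mul_div_pow (hz : ‖z‖ < 1) (hτ : ‖τ‖ < 1) :
    Summable fun p : ℕ × ℕ => z ^ (p.2 + 1) * (τ / ((p.2 : ℂ) + 1)) ^ (p.1 + 1) := by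
  have hgeom {w : ℂ} (hw : ‖w‖ < 1) : Summable fun n : ℕ => ‖w‖ ^ (n + 1) :=
    (summable_nat_add_iff 1).2 (summable_geometric_of_lt_one (norm_nonneg w) hw)
  refine .of_norm_bounded ((hgeom hτ).mul_of_nonneg (hgeom hz) (fun _ => by positivity)
    fun _ => by positivity) fun ⟨n, k⟩ => ?_
  rw [norm_mul, norm_pow, norm_pow, norm_div, norm_natCast_add_one, mul_comm]
  gcongr
  exact div_le_self (norm_nonneg τ) (by simp)

/-- The generating function `∑ Li_n(z) τ ^ n` over `n ≥ 1`, in closed form. -/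
def polyLiGenFun (z τ : ℂ) : ℂ :=
  z * τ * lerchPhi z (1 - τ)

lemma one_sub_re_pos (hτ : ‖τ‖ < 1) : 0 < (1 - τ).re := by
  simpa using (Complex.re_le_norm τ).trans_lt hτ

lemma hasSum_polyLi_mul_pow (hz : ‖z‖ < 1) (hτ : ‖τ‖ < 1) :
    HasSum (fun n : ℕ => polyLi (n + 1) z * τ ^ (n + 1)) (polyLiGenFun z τ) := by
  have hsum := summable_pow_mul_div_pow hz hτ
  have hrow (n : ℕ) : HasSum (fun k : ℕ => z ^ (k + 1) * (τ / ((k : ℂ) + 1)) ^ (n + 1))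
      (polyLi (n + 1) z * τ ^ (n + 1)) := by
    refine ((summable_polyLi hz (n + 1)).hasSum.mul_right (τ ^ (n + 1))).congr_fun fun k => ?_
    rw [div_pow, div_mul_eq_mul_div, mul_div_assoc]
  have hcol (k : ℕ) : HasSum (fun n : ℕ => z ^ (k + 1) * (τ / ((k : ℂ) + 1)) ^ (n + 1))
      (z * τ * (z ^ k / (k + (1 - τ)))) := by
    have hk : (k : ℂ) + 1 ≠ 0 := k.cast_add_one_ne_zero
    have hkτ : (k : ℂ) + 1 - τ ≠ 0 := by
      rw [add_sub_assoc, add_comm]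
      exact add_natCast_ne_zero_of_re_pos (one_sub_re_pos hτ) k
    have hratio : ‖τ / ((k : ℂ) + 1)‖ < 1 := by
      rw [norm_div, norm_natCast_add_one]
      exact (div_le_self (norm_nonneg τ) (by simp)).trans_lt hτ
    have hvalue : z * τ * (z ^ k / (k + (1 - τ))) =
        z ^ (k + 1) * (τ / ((k : ℂ) + 1)) * (1 - τ / ((k : ℂ) + 1))⁻¹ := by
      rw [one_sub_div hk, ← add_sub_assoc]
      field_simp
      ring
    rw [hvalue]
    exact ((hasSum_geometric_of_norm_lt_one hratio).mul_left _).congr_fun fun n => by ring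
  have htotal : HasSum (fun k : ℕ => z * τ * (z ^ k / (k + (1 - τ))))
      (∑' p : ℕ × ℕ, z ^ (p.2 + 1) * (τ / ((p.2 : ℂ) + 1)) ^ (p.1 + 1)) :=
    ((Equiv.prodComm ℕ ℕ).hasSum_iff.2 hsum.hasSum).prod_fiberwise hcol
  rw [polyLiGenFun, lerchPhi, ← tsum_mul_left, htotal.tsum_eq]
  exact hsum.hasSum.prod_fiberwise hrow

lemma differentiableOn_polyLiGenFun (hz : ‖z‖ < 1) :
    DifferentiableOn ℂ (polyLiGenFun z) (Metric.ball 0 1) :=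
  (differentiableOn_id.const_mul z).mul ((differentiableOn_lerchPhi hz).comp
    (differentiableOn_id.const_sub 1) fun _ hτ => one_sub_re_pos (mem_ball_zero_iff.1 hτ))

lemma polyLiGenFun_neg (hz : ‖z‖ < 1) {x : ℂ} (hx : 0 < x.re) :
    polyLiGenFun z (-x) = 1 - x * lerchPhi z x := by
  have hx0 : x ≠ 0 := by simpa using add_natCast_ne_zero_of_re_pos hx 0
  rw [polyLiGenFun, lerchPhi_shift hz hx 1, sub_neg_eq_add, add_comm 1 x]
  simp only [range_one, sum_singleton, pow_zero, Nat.cast_zero, zero_add, pow_one, Nat.cast_one]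
  field_simp
  ring

end GeneratingFunction

section Ladders

variable {z : ℂ}

lemma polyLi_conj (n : ℕ) (z : ℂ) : polyLi n (conj z) = conj (polyLi n z) := by
  simp only [polyLi, Complex.conj_tsum, map_div₀, map_pow, map_add, map_one, Complex.conj_natCast]

lemma polyLi_add_polyLi_neg (hz : ‖z‖ < 1) (n : ℕ) :
    polyLi n z + polyLi n (-z) = 2 / 2 ^ n * polyLi n (z ^ 2) := by
  have hneg : ‖-z‖ < 1 := by rwa [norm_neg]
  have hsq : ‖z ^ 2‖ < 1 := by
    rw [norm_pow]
    exact pow_lt_one₀ (norm_nonneg z) hz two_ne_zero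
  have hsum := (summable_polyLi hz n).hasSum.add (summable_polyLi hneg n).hasSum
  refine hsum.unique ?_
  rw [← zero_add (2 / 2 ^ n * _)]
  refine HasSum.even_add_odd ?_ ?_
  · refine hasSum_zero.congr_fun fun k => ?_
    rw [(odd_two_mul_add_one k).neg_pow]
    ring
  · refine ((summable_polyLi hsq n).hasSum.mul_left (2 / 2 ^ n)).congr_fun fun k => ?_
    rw [add_assoc, Even.neg_pow ⟨k + 1, by ring⟩]
    push_cast
    rw [show (2 * k + 1 + 1 : ℂ) = 2 * (k + 1) by ring, mul_pow, ← pow_mul]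
    ring

lemma ofReal_re_polyLi (n : ℕ) (z : ℂ) :
    ((polyLi n z).re : ℂ) = (polyLi n z + polyLi n (conj z)) / 2 := by
  rw [polyLi_conj, Complex.re_eq_add_conj]

lemma ofReal_re_polyLi_of_re_eq_zero (hz : ‖z‖ < 1) (hre : z.re = 0) (n : ℕ) :
    ((polyLi n z).re : ℂ) = polyLi n (z ^ 2) / 2 ^ n := by
  have hconj : conj z = -z := by
    apply Complex.ext <;> simp [hre]
  rw [ofReal_re_polyLi, hconj, polyLi_add_polyLi_neg hz]
  ring

lemma ofReal_re_ofReal_mul (r : ℝ) (w : ℂ) : (((r * w : ℂ).re : ℝ) : ℂ) = r * (w.re : ℂ) := by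
  rw [Complex.re_ofReal_mul, Complex.ofReal_mul]

lemma two_thirds_zpow_succ_sub_one (n : ℕ) :
    (2 / 3 : ℂ) ^ (((n + 1 : ℕ) : ℤ) - 1) = ((2 / 3) ^ n : ℝ) := by
  push_cast
  rw [add_sub_cancel_right, zpow_natCast]

lemma norm_lt_one_of_norm_sq_lt_one (hz : ‖z ^ 2‖ < 1) : ‖z‖ < 1 := by
  rw [norm_pow] at hz
  exact (sq_lt_one_iff₀ (norm_nonneg z)).1 hz

lemma sq_ofReal_sqrt {x : ℝ} (hx : 0 ≤ x) : (√x : ℂ) ^ 2 = x := by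
  rw [← Complex.ofReal_pow, Real.sq_sqrt hx]

lemma ladderC_succ (n : ℕ) :
    (ladderC (n + 1) : ℂ) = 3 / 2 * ((1 / 3) ^ (n + 1) * polyLi (n + 1) (-1 / 8)) -
      polyLi (n + 1) (-1 / 2) := by
  have h8 : (Complex.I / (√8 : ℂ)) ^ 2 = -1 / 8 := by
    rw [div_pow, sq_ofReal_sqrt (by norm_num), Complex.I_sq, Complex.ofReal_ofNat]
  have h2 : (-Complex.I / (√2 : ℂ)) ^ 2 = -1 / 2 := by
    rw [div_pow, sq_ofReal_sqrt (by norm_num), neg_sq, Complex.I_sq, Complex.ofReal_ofNat]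
  have hLi8 := ofReal_re_polyLi_of_re_eq_zero (z := Complex.I / (√8 : ℂ))
    (norm_lt_one_of_norm_sq_lt_one (by norm_num [h8])) (by simp [Complex.div_ofReal_re]) (n + 1)
  have hLi2 := ofReal_re_polyLi_of_re_eq_zero (z := -Complex.I / (√2 : ℂ))
    (norm_lt_one_of_norm_sq_lt_one (by norm_num [h2])) (by simp [Complex.div_ofReal_re]) (n + 1)
  have htwo : (2 : ℂ) ^ (n + 1) = ((2 ^ (n + 1) : ℝ) : ℂ) := by
    push_cast
    rfl
  rw [ladderC, two_thirds_zpow_succ_sub_one, htwo, Complex.sub_re, Complex.ofReal_sub,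
    ofReal_re_ofReal_mul, ofReal_re_ofReal_mul, hLi8, hLi2, h8, h2]
  push_cast
  simp only [div_pow, pow_succ, one_pow]
  field_simp

lemma ladderD_succ (n : ℕ) :
    (ladderD (n + 1) : ℂ) = 3 / 4 * ((2 / 3) ^ (n + 1) * (polyLi (n + 1) ((1 + Complex.I) / 4) +
      polyLi (n + 1) (conj ((1 + Complex.I) / 4)))) -
      (1 / 2) ^ (n + 1) * polyLi (n + 1) (-1 / 4) := by
  have h4 : (-Complex.I / 2) ^ 2 = -1 / 4 := by
    rw [div_pow, neg_sq, Complex.I_sq]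
    norm_num
  have hLi4 := ofReal_re_polyLi_of_re_eq_zero (z := -Complex.I / 2)
    (norm_lt_one_of_norm_sq_lt_one (by norm_num [h4])) (by simp) (n + 1)
  rw [ladderD, two_thirds_zpow_succ_sub_one, Complex.sub_re, Complex.ofReal_sub,
    ofReal_re_ofReal_mul, hLi4, h4, ofReal_re_polyLi, one_div_pow]
  push_cast
  ring

lemma norm_mul_lt_one {c t : ℂ} {R : ℝ} (hc : c ≠ 0) (hcR : ‖c‖ * R ≤ 1) (ht : ‖t‖ < R) :
    ‖c * t‖ < 1 := by
  rw [norm_mul]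
  exact (mul_lt_mul_of_pos_left ht (norm_pos_iff.2 hc)).trans_le hcR

lemma hasSum_ladderC {t : ℂ} (ht : ‖t‖ < 1) :
    HasSum (fun n : ℕ => (ladderC (n + 1) : ℂ) * t ^ (n + 1))
      (3 / 2 * polyLiGenFun (-1 / 8) (1 / 3 * t) - polyLiGenFun (-1 / 2) t) := by
  have ht3 : ‖1 / 3 * t‖ < 1 := norm_mul_lt_one (by norm_num) (by norm_num) ht
  refine (((hasSum_polyLi_mul_pow (by norm_num) ht3).mul_left (3 / 2)).sub
    (hasSum_polyLi_mul_pow (by norm_num) ht)).congr_fun fun n => ?_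
  rw [ladderC_succ]
  ring

lemma hasSum_ladderD {t : ℂ} (ht : ‖t‖ < 3 / 2) :
    HasSum (fun n : ℕ => (ladderD (n + 1) : ℂ) * t ^ (n + 1))
      (3 / 4 * (polyLiGenFun ((1 + Complex.I) / 4) (2 / 3 * t) +
        polyLiGenFun (conj ((1 + Complex.I) / 4)) (2 / 3 * t)) -
        polyLiGenFun (-1 / 4) (1 / 2 * t)) := by
  have ht23 : ‖2 / 3 * t‖ < 1 := norm_mul_lt_one (by norm_num) (by norm_num) ht
  have ht2 : ‖1 / 2 * t‖ < 1 := norm_mul_lt_one (by norm_num) (by norm_num) ht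
  refine ((((hasSum_polyLi_mul_pow norm_one_add_I_div_four_lt_one ht23).add
    (hasSum_polyLi_mul_pow norm_conj_one_add_I_div_four_lt_one ht23)).mul_left (3 / 4)).sub
    (hasSum_polyLi_mul_pow (by norm_num) ht2)).congr_fun fun n => ?_
  rw [ladderD_succ]
  ring

end Ladders

section Continuation

lemma eqOn_of_eventually_eq_neg_real {f g : ℂ → ℂ} {U : Set ℂ} (hU : IsOpen U)
    (hUc : IsPreconnected U) (h0 : 0 ∈ U) (hf : DifferentiableOn ℂ f U)
    (hg : DifferentiableOn ℂ g U) (hfg : ∀ᶠ x : ℝ in 𝓝[<] 0, f x = g x) : Set.EqOn f g U := by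
  have hlim : Tendsto (fun x : ℝ => (x : ℂ)) (𝓝[<] 0) (𝓝[≠] 0) := by
    refine tendsto_nhdsWithin_iff.2 ⟨?_, ?_⟩
    · exact (Complex.continuous_ofReal.tendsto' 0 0 Complex.ofReal_zero).mono_left
        nhdsWithin_le_nhds
    · filter_upwards [self_mem_nhdsWithin] with x (hx : x < 0)
      simpa using hx.ne
  exact (hf.analyticOnNhd hU).eqOn_of_preconnected_of_frequently_eq (hg.analyticOnNhd hU) hUc h0
    (hlim.frequently hfg.frequently)

lemma ball_subset_re_lt (R : ℝ) : Metric.ball (0 : ℂ) R ⊆ {t : ℂ | t.re < R} := fun t ht =>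
  (Complex.re_le_norm t).trans_lt (mem_ball_zero_iff.1 ht)

lemma isOpen_re_lt (R : ℝ) : IsOpen {t : ℂ | t.re < R} :=
  isOpen_lt Complex.continuous_re continuous_const

lemma one_sub_div_two_re_pos {t : ℂ} (ht : t.re < 3 / 2) : 0 < (1 - t / 2).re := by
  rw [Complex.sub_re, Complex.one_re, Complex.div_ofNat_re]
  linarith

lemma one_sub_two_mul_div_three_re_pos {t : ℂ} (ht : t.re < 3 / 2) : 0 < (1 - 2 * t / 3).re := by
  rw [mul_div_right_comm, Complex.sub_re, Complex.one_re,
    show (2 / 3 : ℂ) = (2 / 3 : ℝ) by push_cast; rfl, Complex.re_ofReal_mul]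
  linarith

lemma hyp3F2_excess_eq (t d : ℂ) :
    (1 - t / 2) + (1 - 2 * t / 3) - -t / 2 - (1 / 2 - t / d) - 1 = 1 / 2 + t / d - 2 * t / 3 := by
  ring

lemma summable_hyp3F2Term_of_re_lt {t d : ℂ} (ht : t.re < 3 / 2)
    (hd : 0 < (1 / 2 + t / d - 2 * t / 3).re) :
    Summable (hyp3F2Term (-t / 2) (1 / 2 - t / d) 1 (1 - t / 2) (1 - 2 * t / 3) 1) :=
  summable_hyp3F2Term_one (add_natCast_ne_zero_of_re_pos (one_sub_div_two_re_pos ht))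
    (add_natCast_ne_zero_of_re_pos (one_sub_two_mul_div_three_re_pos ht))
    (by rwa [hyp3F2_excess_eq])

lemma differentiableOn_hyp3F2_of_re_lt {U : Set ℂ} {d : ℂ} (hU : IsOpen U)
    (hre : ∀ t ∈ U, t.re < 3 / 2) (hd : ∀ t ∈ U, 0 < (1 / 2 + t / d - 2 * t / 3).re) :
    DifferentiableOn ℂ
      (fun t => hyp3F2 (-t / 2) (1 / 2 - t / d) 1 (1 - t / 2) (1 - 2 * t / 3) 1) U :=
  differentiableOn_hyp3F2_one hU (by fun_prop) (by fun_prop) (by fun_prop) (by fun_prop)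
    (by fun_prop)
    (fun t ht => add_natCast_ne_zero_of_re_pos (one_sub_div_two_re_pos (hre t ht)))
    (fun t ht => add_natCast_ne_zero_of_re_pos (one_sub_two_mul_div_three_re_pos (hre t ht)))
    (fun t ht => by rw [hyp3F2_excess_eq]; exact hd t ht)

lemma excess_re_pos_of_re_lt_one {t : ℂ} (ht : t.re < 1) :
    0 < (1 / 2 + t / 6 - 2 * t / 3).re := by
  rw [show 1 / 2 + t / 6 - 2 * t / 3 = (1 - t) / 2 by ring, Complex.div_ofNat_re,
    Complex.sub_re, Complex.one_re]
  linarith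

lemma excess_re_pos_of_re_lt_three_halves {t : ℂ} (ht : t.re < 3 / 2) :
    0 < (1 / 2 + t / 3 - 2 * t / 3).re := by
  rw [show 1 / 2 + t / 3 - 2 * t / 3 = (3 / 2 - t) / 3 by ring, Complex.div_ofNat_re,
    Complex.sub_re, show (3 / 2 : ℂ) = (3 / 2 : ℝ) by push_cast; rfl, Complex.ofReal_re]
  linarith

lemma summable_hyp3F2Term_ladderC {t : ℂ} (ht : t.re < 1) :
    Summable (hyp3F2Term (-t / 2) (1 / 2 - t / 6) 1 (1 - t / 2) (1 - 2 * t / 3) 1) :=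
  summable_hyp3F2Term_of_re_lt (by linarith) (excess_re_pos_of_re_lt_one ht)

lemma summable_hyp3F2Term_ladderD {t : ℂ} (ht : t.re < 3 / 2) :
    Summable (hyp3F2Term (-t / 2) (1 / 2 - t / 3) 1 (1 - t / 2) (1 - 2 * t / 3) 1) :=
  summable_hyp3F2Term_of_re_lt ht (excess_re_pos_of_re_lt_three_halves ht)

lemma differentiableOn_hyp3F2_ladderC :
    DifferentiableOn ℂ
      (fun t : ℂ => hyp3F2 (-t / 2) (1 / 2 - t / 6) 1 (1 - t / 2) (1 - 2 * t / 3) 1)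
      {t : ℂ | t.re < 1} :=
  differentiableOn_hyp3F2_of_re_lt (isOpen_re_lt 1)
    (fun _ ht => LT.lt.trans ht (by norm_num)) fun _ => excess_re_pos_of_re_lt_one

lemma differentiableOn_hyp3F2_ladderD :
    DifferentiableOn ℂ
      (fun t : ℂ => hyp3F2 (-t / 2) (1 / 2 - t / 3) 1 (1 - t / 2) (1 - 2 * t / 3) 1)
      {t : ℂ | t.re < 3 / 2} :=
  differentiableOn_hyp3F2_of_re_lt (isOpen_re_lt _) (fun _ => id)
    fun _ => excess_re_pos_of_re_lt_three_halves

lemma differentiableOn_polyLiGenFun_mul {z c : ℂ} {R : ℝ} (hz : ‖z‖ < 1) (hc : c ≠ 0)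
    (hcR : ‖c‖ * R ≤ 1) :
    DifferentiableOn ℂ (fun t => polyLiGenFun z (c * t)) (Metric.ball 0 R) :=
  (differentiableOn_polyLiGenFun hz).comp (by fun_prop) fun _ ht =>
    mem_ball_zero_iff.2 (norm_mul_lt_one hc hcR (mem_ball_zero_iff.1 ht))

lemma polyLiGenFun_sub_eq_of_neg {x : ℝ} (hx : x < 0) :
    2 * (3 / 2 * polyLiGenFun (-1 / 8) (1 / 3 * x) - polyLiGenFun (-1 / 2) x) =
      1 - hyp3F2 (-x / 2) (1 / 2 - x / 6) 1 (1 - x / 2) (1 - 2 * x / 3) 1 := by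
  obtain ⟨v, hv, rfl⟩ : ∃ v : ℝ, 0 < v ∧ -(6 * v) = x := ⟨-x / 6, by linarith, by ring⟩
  have h8 := polyLiGenFun_neg (z := -1 / 8) (by norm_num) (x := ((2 * v : ℝ) : ℂ))
    (by rw [Complex.ofReal_re]; positivity)
  have h2 := polyLiGenFun_neg (z := -1 / 2) (by norm_num) (x := ((6 * v : ℝ) : ℂ))
    (by rw [Complex.ofReal_re]; positivity)
  have hF := hyp3F2_neg_six_mul 1 hv
  rw [tsum_ladderTerm_one hv] at hF
  push_cast at h8 h2 hF ⊢
  have hτ : (1 / 3 : ℂ) * -(6 * v) = -(2 * v) := by ring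
  have ha₁ : -(-(6 * v) : ℂ) / 2 = 3 * v := by ring
  have ha₂ : (1 / 2 : ℂ) - -(6 * v) / 6 = 1 / 2 + 1 * v := by ring
  have hb₁ : (1 : ℂ) - -(6 * v) / 2 = 3 * v + 1 := by ring
  have hb₂ : (1 : ℂ) - 2 * -(6 * v) / 3 = 1 + 4 * v := by ring
  rw [hτ, h8, h2, ha₁, ha₂, hb₁, hb₂, hF]
  ring

lemma polyLiGenFun_add_sub_eq_of_neg {x : ℝ} (hx : x < 0) :
    2 * (3 / 4 * (polyLiGenFun ((1 + Complex.I) / 4) (2 / 3 * x) +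
        polyLiGenFun (conj ((1 + Complex.I) / 4)) (2 / 3 * x)) -
        polyLiGenFun (-1 / 4) (1 / 2 * x)) =
      1 - hyp3F2 (-x / 2) (1 / 2 - x / 3) 1 (1 - x / 2) (1 - 2 * x / 3) 1 := by
  obtain ⟨v, hv, rfl⟩ : ∃ v : ℝ, 0 < v ∧ -(6 * v) = x := ⟨-x / 6, by linarith, by ring⟩
  have hI {z : ℂ} (hz : ‖z‖ < 1) := polyLiGenFun_neg hz (x := ((4 * v : ℝ) : ℂ))
    (by rw [Complex.ofReal_re]; positivity)
  have h4 := polyLiGenFun_neg (z := -1 / 4) (by norm_num) (x := ((3 * v : ℝ) : ℂ))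
    (by rw [Complex.ofReal_re]; positivity)
  have hF := hyp3F2_neg_six_mul 2 hv
  rw [tsum_ladderTerm_two hv] at hF
  push_cast at hI h4 hF ⊢
  have hτ : (2 / 3 : ℂ) * -(6 * v) = -(4 * v) := by ring
  have hτ' : (1 / 2 : ℂ) * -(6 * v) = -(3 * v) := by ring
  have ha₁ : -(-(6 * v) : ℂ) / 2 = 3 * v := by ring
  have ha₂ : (1 / 2 : ℂ) - -(6 * v) / 3 = 1 / 2 + 2 * v := by ring
  have hb₁ : (1 : ℂ) - -(6 * v) / 2 = 3 * v + 1 := by ring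
  have hb₂ : (1 : ℂ) - 2 * -(6 * v) / 3 = 1 + 4 * v := by ring
  rw [hτ, hτ', hI norm_one_add_I_div_four_lt_one, hI norm_conj_one_add_I_div_four_lt_one, h4,
    ha₁, ha₂, hb₁, hb₂, hF]
  ring

lemma two_mul_tsum_ladderC {t : ℂ} (ht : ‖t‖ < 1) :
    2 * ∑' n : ℕ, (ladderC (n + 1) : ℂ) * t ^ (n + 1) =
      1 - hyp3F2 (-t / 2) (1 / 2 - t / 6) 1 (1 - t / 2) (1 - 2 * t / 3) 1 := by
  rw [(hasSum_ladderC ht).tsum_eq]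
  have hladder : DifferentiableOn ℂ (fun t => 2 * (3 / 2 * polyLiGenFun (-1 / 8) (1 / 3 * t) -
      polyLiGenFun (-1 / 2) t)) (Metric.ball 0 1) :=
    (((differentiableOn_polyLiGenFun_mul (by norm_num) (by norm_num) (by norm_num)).const_mul
      _).sub (differentiableOn_polyLiGenFun (by norm_num))).const_mul _
  exact eqOn_of_eventually_eq_neg_real Metric.isOpen_ball (convex_ball 0 1).isPreconnected
    (Metric.mem_ball_self one_pos) hladder
    ((differentiableOn_hyp3F2_ladderC.mono (ball_subset_re_lt 1)).const_sub 1)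
    (eventually_mem_nhdsWithin.mono fun _ => polyLiGenFun_sub_eq_of_neg)
    (mem_ball_zero_iff.2 ht)

lemma two_mul_tsum_ladderD {t : ℂ} (ht : ‖t‖ < 3 / 2) :
    2 * ∑' n : ℕ, (ladderD (n + 1) : ℂ) * t ^ (n + 1) =
      1 - hyp3F2 (-t / 2) (1 / 2 - t / 3) 1 (1 - t / 2) (1 - 2 * t / 3) 1 := by
  rw [(hasSum_ladderD ht).tsum_eq]
  have hgen {z : ℂ} (hz : ‖z‖ < 1) :
      DifferentiableOn ℂ (fun t => polyLiGenFun z (2 / 3 * t)) (Metric.ball 0 (3 / 2)) :=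
    differentiableOn_polyLiGenFun_mul hz (by norm_num) (by norm_num)
  have hladder : DifferentiableOn ℂ (fun t =>
      2 * (3 / 4 * (polyLiGenFun ((1 + Complex.I) / 4) (2 / 3 * t) +
        polyLiGenFun (conj ((1 + Complex.I) / 4)) (2 / 3 * t)) -
        polyLiGenFun (-1 / 4) (1 / 2 * t))) (Metric.ball 0 (3 / 2)) :=
    ((((hgen norm_one_add_I_div_four_lt_one).add
      (hgen norm_conj_one_add_I_div_four_lt_one)).const_mul _).sub
      (differentiableOn_polyLiGenFun_mul (by norm_num) (by norm_num) (by norm_num))).const_mul _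
  exact eqOn_of_eventually_eq_neg_real Metric.isOpen_ball (convex_ball 0 _).isPreconnected
    (Metric.mem_ball_self (by norm_num)) hladder
    ((differentiableOn_hyp3F2_ladderD.mono (ball_subset_re_lt _)).const_sub 1)
    (eventually_mem_nhdsWithin.mono fun _ => polyLiGenFun_add_sub_eq_of_neg)
    (mem_ball_zero_iff.2 ht)

end Continuation

end

theorem mainTheorem6 :
    ((∀ t : ℂ, t.re < 1 →
        Summable (hyp3F2Term (-t / 2) (1 / 2 - t / 6) 1 (1 - t / 2) (1 - 2 * t / 3) 1)) ∧
      DifferentiableOn ℂ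
        (fun t : ℂ => hyp3F2 (-t / 2) (1 / 2 - t / 6) 1 (1 - t / 2) (1 - 2 * t / 3) 1)
        {t : ℂ | t.re < 1} ∧
      ∀ t : ℂ, ‖t‖ < 1 →
        Summable (fun n : ℕ => (ladderC (n + 1) : ℂ) * t ^ (n + 1)) ∧
        2 * ∑' n : ℕ, (ladderC (n + 1) : ℂ) * t ^ (n + 1) =
          1 - hyp3F2 (-t / 2) (1 / 2 - t / 6) 1 (1 - t / 2) (1 - 2 * t / 3) 1) ∧
    ((∀ t : ℂ, t.re < 3 / 2 →
        Summable (hyp3F2Term (-t / 2) (1 / 2 - t / 3) 1 (1 - t / 2) (1 - 2 * t / 3) 1)) ∧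
      DifferentiableOn ℂ
        (fun t : ℂ => hyp3F2 (-t / 2) (1 / 2 - t / 3) 1 (1 - t / 2) (1 - 2 * t / 3) 1)
        {t : ℂ | t.re < 3 / 2} ∧
      ∀ t : ℂ, ‖t‖ < 3 / 2 →
        Summable (fun n : ℕ => (ladderD (n + 1) : ℂ) * t ^ (n + 1)) ∧
        2 * ∑' n : ℕ, (ladderD (n + 1) : ℂ) * t ^ (n + 1) =
          1 - hyp3F2 (-t / 2) (1 / 2 - t / 3) 1 (1 - t / 2) (1 - 2 * t / 3) 1) := by
  refine ⟨⟨fun t => summable_hyp3F2Term_ladderC, differentiableOn_hyp3F2_ladderC, fun t ht => ?_⟩,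
    ⟨fun t => summable_hyp3F2Term_ladderD, differentiableOn_hyp3F2_ladderD, fun t ht => ?_⟩⟩
  · exact ⟨(hasSum_ladderC ht).summable, two_mul_tsum_ladderC ht⟩
  · exact ⟨(hasSum_ladderD ht).summable, two_mul_tsum_ladderD ht⟩
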